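/- Let $n\ge 0$ and $\gamma\ge 1$ be integers, write $[n]=\{1,\dots,n\}$, and let $u_0>0$ and $u_1\ge u_2\ge\cdots\ge u_n\ge 0$ be real numbers. For $x\in[0,1]^n$ put $$\phi(x)=\max_y\left\{\frac{\sum_{j\in[n]}u_jy_j}{\sum_{j\in[n]}u_jy_j+u_0}\;:\;\sum_{j\in[n]}y_j\le\gamma,\ y_j\le x_j,\ y_j\in[0,1]\ \ \forall j\in[n]\right\},$$ and let $\mathcal X=\{(w,x)\in\mathbb R\times\{0,1\}^n: w\le\phi(x)\}$. For disjoint $\mathcal S_0,\mathcal S_1\subseteq[n]$ let $\mathcal X(\mathcal S_0,\mathcal S_1)$ be the set of $(w,x)\in\mathcal X$ with $x_j=0$ for $j\in\mathcal S_0$ and $x_j=1$ for $j\in\mathcal S_1$. For $\mathcal S\subseteq[n]$ and $j\in[n]$ put, with $u(\mathcal S')=\sum_{j\in\mathcal S'}u_j$, $$\Phi(\mathcal S)=\max\left\{\frac{u(\mathcal S')}{u(\mathcal S')+u_0}:\mathcal S'\subseteq\mathcal S,\ |\mathcal S'|\le\gamma\right\},\qquad \rho_j(\mathcal S)=\Phi(\mathcal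 S\cup\{j\})-\Phi(\mathcal S).$$ An inequality $w\le c+\sum_{j}a_jx_j$ is facet-defining for $\operatorname{conv}(\mathcal X)$ if every point of $\operatorname{conv}(\mathcal X)$ satisfies it and the set of points of $\operatorname{conv}(\mathcal X)$ that satisfy it with equality is nonempty and has affine dimension $\dim\operatorname{conv}(\mathcal X)-1$. Let $\mathcal S\subseteq[n]$ and $s=|\mathcal S|$. Then the following hold. (1) For every ordering $j_1,\dots,j_s$ of $\mathcal S$, the down-lifted submodular inequality $$w\le\Phi(\mathcal S)+\sum_{j\in[n]\setminus\mathcal S}\rho_j(\mathcal S)x_j-\sum_{j\in\mathcal S}\eta_j(1-x_j)$$ is facet-defining for $\operatorname{conv}(\mathcal X)$, where the coefficients are defined successively for $\ell=1,\dots,s$ by $$\eta_{j_\ell}=\Phi(\mathcal S)-\sum_{\tau=1}^{\ell-1}\eta_{j_\tau}-\max\left\{w-\sum_{j\in[n]\setminus\mathcal S}\rho_j(\mathcal S)x_j-\sum_{\tau=1}^{\ell-1}\eta_{j_\tau}x_{j_\tau}:(w,x)\in\mathcal X(\{j_\ell\},\{j_{\ell+1},\dots,j_s\})\right\}.$$ (2)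 For every ordering $j_1,\dots,j_{n-s}$ of $[n]\setminus\mathcal S$, the up-lifted submodular inequality $$w\le\Phi(\mathcal S)-\sum_{j\in\mathcal S}\rho_j(\mathcal S\setminus\{j\})(1-x_j)+\sum_{j\in[n]\setminus\mathcal S}\zeta_jx_j$$ is facet-defining for $\operatorname{conv}(\mathcal X)$, where the coefficients are defined successively for $\ell=1,\dots,n-s$ by $$\zeta_{j_\ell}=-\Phi(\mathcal S)+\sum_{j\in\mathcal S}\rho_j(\mathcal S\setminus\{j\})+\max\left\{w-\sum_{j\in\mathcal S}\rho_j(\mathcal S\setminus\{j\})x_j-\sum_{\tau=1}^{\ell-1}\zeta_{j_\tau}x_{j_\tau}:(w,x)\in\mathcal X(\{j_{\ell+1},\dots,j_{n-s}\},\{j_\ell\})\right\}.$$ -/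

import Mathlib

namespace LiftedSubmodular

noncomputable section

variable {n : ℕ}

/-- The objective `∑ u_j y_j / (∑ u_j y_j + u₀)`. -/
def share (u₀ : ℝ) (u : Fin n → ℝ) (y : Fin n → ℝ) : ℝ :=
  (∑ j, u j * y j) / (∑ j, u j * y j + u₀)

/-- The feasible region of the maximization problem that defines `φ(x)`. -/
def allocations (γ : ℕ) (x : Fin n → ℝ) : Set (Fin n → ℝ) :=
  {y | ∑ j, y j ≤ (γ : ℝ) ∧ (∀ j, y j ≤ x j) ∧ ∀ j, y j ∈ Set.Icc (0 : ℝ) 1}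

/-- `φ(x)`, the maximum of `share` over the (fractional) allocations; it is attained, see
`exists_isGreatest_share`. -/
def phi (u₀ : ℝ) (u : Fin n → ℝ) (γ : ℕ) (x : Fin n → ℝ) : ℝ :=
  sSup (share u₀ u '' allocations γ x)

/-- `Φ(S) = max { u(S') / (u(S') + u₀) : S' ⊆ S, |S'| ≤ γ }`. -/
def Phi (u₀ : ℝ) (u : Fin n → ℝ) (γ : ℕ) (S : Finset (Fin n)) : ℝ :=
  (S.powerset.filter fun S' => S'.card ≤ γ).sup' ⟨∅, by simp⟩
    fun S' => (∑ j ∈ S', u j) / (∑ j ∈ S', u j + u₀)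

/-- The marginal gain `ρ_j(S) = Φ(S ∪ {j}) - Φ(S)`. -/
def rho (u₀ : ℝ) (u : Fin n → ℝ) (γ : ℕ) (j : Fin n) (S : Finset (Fin n)) : ℝ :=
  Phi u₀ u γ (insert j S) - Phi u₀ u γ S

/-- The mixed 0-1 set `X = {(w, x) ∈ ℝ × {0,1}ⁿ : w ≤ φ(x)}`. -/
def X (u₀ : ℝ) (u : Fin n → ℝ) (γ : ℕ) : Set (ℝ × (Fin n → ℝ)) :=
  {p | (∀ j, p.2 j = 0 ∨ p.2 j = 1) ∧ p.1 ≤ phi u₀ u γ p.2}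

/-- `X(S₀, S₁)`: the points of `X` with `x_j = 0` on `S₀` and `x_j = 1` on `S₁`. -/
def XRestr (u₀ : ℝ) (u : Fin n → ℝ) (γ : ℕ) (S₀ S₁ : Finset (Fin n)) :
    Set (ℝ × (Fin n → ℝ)) :=
  {p | p ∈ X u₀ u γ ∧ (∀ j ∈ S₀, p.2 j = 0) ∧ ∀ j ∈ S₁, p.2 j = 1}

/-- The optimal value `max {w - a(x) : (w, x) ∈ X(S₀, S₁)}` of a lifting problem; it is attained
whenever `S₀` and `S₁` are disjoint, see `isGreatest_liftMax`. -/
def liftMax (u₀ : ℝ) (u : Fin n → ℝ) (γ : ℕ) (S₀ S₁ : Finset (Fin n))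
    (a : (Fin n → ℝ) → ℝ) : ℝ :=
  sSup ((fun p : ℝ × (Fin n → ℝ) => p.1 - a p.2) '' XRestr u₀ u γ S₀ S₁)

/-- The down-lifting coefficients: for an ordering `σ` of `S`, the number `eta u₀ u γ S σ ℓ` is
the coefficient `η_{σ ℓ}`. -/
def eta (u₀ : ℝ) (u : Fin n → ℝ) (γ : ℕ) (S : Finset (Fin n)) (σ : Fin S.card ≃ S)
    (ℓ : Fin S.card) : ℝ :=
  Phi u₀ u γ S - ∑ τ : {τ // τ < ℓ}, eta u₀ u γ S σ τ.1
    - liftMax u₀ u γ {(σ ℓ : Fin n)} ((Finset.Ioi ℓ).image fun τ => (σ τ : Fin n))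
        (fun x => ∑ j ∈ Sᶜ, rho u₀ u γ j S * x j
          + ∑ τ : {τ // τ < ℓ}, eta u₀ u γ S σ τ.1 * x (σ τ.1))
termination_by ℓ.val
decreasing_by all_goals exact τ.2

/-- The up-lifting coefficients: for an ordering `σ` of the complement of `S`, the number
`zeta u₀ u γ S σ ℓ` is the coefficient `ζ_{σ ℓ}`. -/
def zeta (u₀ : ℝ) (u : Fin n → ℝ) (γ : ℕ) (S : Finset (Fin n))
    (σ : Fin Sᶜ.card ≃ (Sᶜ : Finset (Fin n))) (ℓ : Fin Sᶜ.card) : ℝ :=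
  - Phi u₀ u γ S + ∑ j ∈ S, rho u₀ u γ j (S.erase j)
    + liftMax u₀ u γ ((Finset.Ioi ℓ).image fun τ => (σ τ : Fin n)) {(σ ℓ : Fin n)}
        (fun x => ∑ j ∈ S, rho u₀ u γ j (S.erase j) * x j
          + ∑ τ : {τ // τ < ℓ}, zeta u₀ u γ S σ τ.1 * x (σ τ.1))
termination_by ℓ.val
decreasing_by all_goals exact τ.2

/-- Right-hand side of the down-lifted submodular inequality. -/
def downLiftedRhs (u₀ : ℝ) (u : Fin n → ℝ) (γ : ℕ) (S : Finset (Fin n)) (σ : Fin S.card ≃ S)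
    (x : Fin n → ℝ) : ℝ :=
  Phi u₀ u γ S + ∑ j ∈ Sᶜ, rho u₀ u γ j S * x j
    - ∑ ℓ, eta u₀ u γ S σ ℓ * (1 - x (σ ℓ))

/-- Right-hand side of the up-lifted submodular inequality. -/
def upLiftedRhs (u₀ : ℝ) (u : Fin n → ℝ) (γ : ℕ) (S : Finset (Fin n))
    (σ : Fin Sᶜ.card ≃ (Sᶜ : Finset (Fin n))) (x : Fin n → ℝ) : ℝ :=
  Phi u₀ u γ S - ∑ j ∈ S, rho u₀ u γ j (S.erase j) * (1 - x j)
    + ∑ ℓ, zeta u₀ u γ S σ ℓ * x (σ ℓ)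

/-- The inequality `w ≤ r(x)` (with `r` affine) defines a facet of the convex set `P`: it is valid
on `P`, and the face of the points of `P` that satisfy it with equality is nonempty and has
(affine) dimension `dim P - 1`. -/
def IsFacetDefining (P : Set (ℝ × (Fin n → ℝ))) (r : (Fin n → ℝ) → ℝ) : Prop :=
  (∀ p ∈ P, p.1 ≤ r p.2) ∧
  {p ∈ P | p.1 = r p.2}.Nonempty ∧
  Module.finrank ℝ (vectorSpan ℝ {p ∈ P | p.1 = r p.2}) + 1
    = Module.finrank ℝ (vectorSpan ℝ P)

/-- The maximum in the definition of `phi` is attained. -/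
theorem exists_isGreatest_share (u₀ : ℝ) (hu₀ : 0 < u₀) (u : Fin n → ℝ) (hu : ∀ j, 0 ≤ u j)
    (γ : ℕ) (x : Fin n → ℝ) (hx : ∀ j, 0 ≤ x j) :
    IsGreatest (share u₀ u '' allocations γ x) (phi u₀ u γ x) := by
  have hne : (allocations γ x).Nonempty := ⟨0, by simp, by simpa using hx, by simp⟩
  have hcl : IsClosed (allocations γ x) := by
    have h1 : IsClosed {y : Fin n → ℝ | ∑ j, y j ≤ (γ : ℝ)} :=
      isClosed_le (by fun_prop) (by fun_prop)
    have h2 : IsClosed {y : Fin n → ℝ | ∀ j, y j ≤ x j} := by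
      simp only [Set.ofPred_forall]
      exact isClosed_iInter fun j => isClosed_le (by fun_prop) (by fun_prop)
    have h3 : IsClosed {y : Fin n → ℝ | ∀ j, y j ∈ Set.Icc (0 : ℝ) 1} := by
      simp only [Set.ofPred_forall]
      exact isClosed_iInter fun j => isClosed_Icc.preimage (continuous_apply j)
    exact h1.inter (h2.inter h3)
  have hc : IsCompact (allocations γ x) :=
    (isCompact_Icc (a := (0 : Fin n → ℝ)) (b := 1)).of_isClosed_subset hcl
      fun y hy => ⟨fun j => (hy.2.2 j).1, fun j => (hy.2.2 j).2⟩
  have hcont : ContinuousOn (share u₀ u) (allocations γ x) := by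
    refine ContinuousOn.div (by fun_prop) (by fun_prop) fun y hy => ?_
    have : 0 ≤ ∑ j, u j * y j := Finset.sum_nonneg fun j _ => mul_nonneg (hu j) (hy.2.2 j).1
    positivity
  exact (hc.image_of_continuousOn hcont).isGreatest_sSup (hne.image _)

/-- The maximum of a lifting problem is attained. -/
theorem isGreatest_liftMax (u₀ : ℝ) (u : Fin n → ℝ) (γ : ℕ) (S₀ S₁ : Finset (Fin n))
    (hS : Disjoint S₀ S₁) (a : (Fin n → ℝ) → ℝ) :
    IsGreatest ((fun p : ℝ × (Fin n → ℝ) => p.1 - a p.2) '' XRestr u₀ u γ S₀ S₁)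
      (liftMax u₀ u γ S₀ S₁ a) := by
  let B : Set (Fin n → ℝ) := {x | (∀ j, x j = 0 ∨ x j = 1) ∧ (∀ j ∈ S₀, x j = 0) ∧
    ∀ j ∈ S₁, x j = 1}
  have hBf : B.Finite :=
    (Set.Finite.pi' (fun _ : Fin n => Set.toFinite ({0, 1} : Set ℝ))).subset
      fun x hx j => by simpa using hx.1 j
  have hBne : B.Nonempty := by
    refine ⟨fun j => if j ∈ S₁ then 1 else 0, fun j => ?_, fun j hj => ?_, fun j hj => ?_⟩
    · by_cases h : j ∈ S₁ <;> simp [h]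
    · simp [Finset.disjoint_left.mp hS hj]
    · simp [hj]
  obtain ⟨x, hx, hmax⟩ := hBf.exists_maximalFor (fun x => phi u₀ u γ x - a x) B hBne
  have hG : IsGreatest ((fun p : ℝ × (Fin n → ℝ) => p.1 - a p.2) '' XRestr u₀ u γ S₀ S₁)
      (phi u₀ u γ x - a x) := by
    refine ⟨⟨(phi u₀ u γ x, x), ⟨⟨hx.1, le_rfl⟩, hx.2.1, hx.2.2⟩, rfl⟩, ?_⟩
    rintro _ ⟨p, ⟨⟨h1, h2⟩, h3, h4⟩, rfl⟩
    have hp : p.2 ∈ B := ⟨h1, h3, h4⟩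
    have : phi u₀ u γ p.2 - a p.2 ≤ phi u₀ u γ x - a x := by
      rcases le_total (phi u₀ u γ x - a x) (phi u₀ u γ p.2 - a p.2) with h | h
      · exact hmax hp h
      · exact h
    simp only
    linarith
  rw [liftMax, hG.csSup_eq]
  exact hG

end

end LiftedSubmodular

namespace LiftedSubmodular

variable {n : ℕ}

/-! ### The ratio function -/

/-! The function `t / (t + u₀)` is increasing and concave for `t ≥ 0`, and an exchange argument on
feasible sets turns this into submodularity of `Phi` (`rho_anti`). Since the knapsack relaxation has
integral optima, `phi` agrees with `Phi` on incidence vectors (`phi_incidence`), so submodularity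
gives both inequalities where nothing has been lifted: for `x = 1` on `S` in the down case, for `x =
0` off `S` in the up case.

Any other 0-1 point has a last lifted coordinate differing from its reference value. It is feasible
for the lifting problem of that coordinate, whose maximum defines the coefficient precisely so that
the inequality holds there and is tight at an optimum.

For the dimension, take as tight points the incidence vector of `S`, its changes in one unlifted
coordinate, and an optimum of every lifting problem. Differences with the first point form a
triangular system spanning `ℝⁿ`, which `isFacetDefining_of_tightPoints` converts into a facet. -/

theorem ratio_le_ratio {u₀ a b : ℝ} (hu₀ : 0 < u₀) (ha : 0 ≤ a) (hab : a ≤ b) :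
    a / (a + u₀) ≤ b / (b + u₀) := by
  rw [div_le_div_iff₀ (by linarith) (by linarith)]
  nlinarith

/-- Concavity: a step `δ` from `t` gains `u₀ δ / ((t + u₀)(t + δ + u₀))`, which decreases in `t`.
The inequality `d + a ≤ b + c`, rather than equal steps, is what the exchange argument supplies. -/
theorem ratio_sub_ratio_le {u₀ a b c d : ℝ} (hu₀ : 0 < u₀) (ha : 0 ≤ a) (hab : a ≤ b)
    (hac : a ≤ c) (hd : 0 ≤ d) (h : d + a ≤ b + c) :
    d / (d + u₀) - c / (c + u₀) ≤ b / (b + u₀) - a / (a + u₀) := by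
  obtain ⟨δ, rfl⟩ : ∃ δ, b = a + δ := ⟨b - a, by ring⟩
  have hδ : 0 ≤ δ := by linarith
  have h1 : d / (d + u₀) ≤ (c + δ) / (c + δ + u₀) := ratio_le_ratio hu₀ hd (by linarith)
  have key : ∀ t, 0 ≤ t → (t + δ) / (t + δ + u₀) - t / (t + u₀)
      = u₀ * δ / ((t + u₀) * (t + δ + u₀)) := by
    intro t ht
    have : t + u₀ ≠ 0 := by positivity
    have : t + δ + u₀ ≠ 0 := by positivity
    field_simp
    ring
  have h2 : u₀ * δ / ((c + u₀) * (c + δ + u₀)) ≤ u₀ * δ / ((a + u₀) * (a + δ + u₀)) := by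
    have : 0 ≤ c + u₀ := by linarith
    gcongr
  have := key a ha
  have := key c (ha.trans hac)
  linarith

/-! ### The set function `Phi` -/

/-- `Phi` is attained at a subset of maximal total weight. -/
theorem exists_Phi_eq {u₀ : ℝ} (hu₀ : 0 < u₀) {u : Fin n → ℝ} (hu : ∀ j, 0 ≤ u j) (γ : ℕ)
    (S : Finset (Fin n)) :
    ∃ P ⊆ S, P.card ≤ γ ∧ Phi u₀ u γ S = (∑ j ∈ P, u j) / (∑ j ∈ P, u j + u₀) ∧
      ∀ Q ⊆ S, Q.card ≤ γ → ∑ j ∈ Q, u j ≤ ∑ j ∈ P, u j := by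
  obtain ⟨P, hP, hmax⟩ := (S.powerset.filter fun S' => S'.card ≤ γ).exists_max_image
    (fun S' => ∑ j ∈ S', u j) ⟨∅, by simp⟩
  simp only [Finset.mem_filter, Finset.mem_powerset] at hP hmax
  refine ⟨P, hP.1, hP.2, le_antisymm ?_ ?_, fun Q h1 h2 => hmax Q ⟨h1, h2⟩⟩
  · refine Finset.sup'_le _ _ fun Q hQ => ?_
    simp only [Finset.mem_filter, Finset.mem_powerset] at hQ
    exact ratio_le_ratio hu₀ (Finset.sum_nonneg fun j _ => hu j) (hmax Q hQ)
  · exact Finset.le_sup' (fun S' => (∑ j ∈ S', u j) / (∑ j ∈ S', u j + u₀))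
      (Finset.mem_filter.2 ⟨Finset.mem_powerset.2 hP.1, hP.2⟩)

/-- Exchange: an element `j` can be moved from a feasible `P ⊆ T ∪ {j}` to a feasible
`Q ⊆ S ⊆ T` without changing the total weight. -/
theorem exists_exchange {u : Fin n → ℝ} {γ : ℕ} {S T P Q : Finset (Fin n)} {j : Fin n}
    (h : S ⊆ T) (hP : P ⊆ insert j T) (hPc : P.card ≤ γ) (hQ : Q ⊆ S) (hQc : Q.card ≤ γ) :
    ∃ P' ⊆ T, ∃ Q' ⊆ insert j S, P'.card ≤ γ ∧ Q'.card ≤ γ ∧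
      ∑ i ∈ P, u i + ∑ i ∈ Q, u i = ∑ i ∈ P', u i + ∑ i ∈ Q', u i := by
  by_cases hPT : P ⊆ T
  · exact ⟨P, hPT, Q, hQ.trans (Finset.subset_insert _ _), hPc, hQc, rfl⟩
  have hjT : j ∉ T := fun hj => hPT (by rwa [Finset.insert_eq_of_mem hj] at hP)
  have hjP : j ∈ P := by
    by_contra hj
    exact hPT ((Finset.subset_insert_iff_of_notMem hj).1 hP)
  have hjQ : j ∉ Q := fun hj => hjT (h (hQ hj))
  have hPe : P.erase j ⊆ T := Finset.subset_insert_iff.1 hP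
  have hsP : ∑ i ∈ P, u i = u j + ∑ i ∈ P.erase j, u i := (Finset.add_sum_erase _ _ hjP).symm
  have hcP : (P.erase j).card + 1 = P.card := Finset.card_erase_add_one hjP
  rcases hQc.lt_or_eq with hlt | heq
  · refine ⟨P.erase j, hPe, insert j Q, Finset.insert_subset_insert _ hQ, by omega, ?_, ?_⟩
    · rw [Finset.card_insert_of_notMem hjQ]; omega
    · rw [Finset.sum_insert hjQ, hsP]; ring
  -- `Q` is full, so `j` must be swapped for some `i`. If `Q ⊆ P`, then `|P| ≤ γ = |Q|` would force
  -- `P = Q`, although only `P` contains `j`.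
  · obtain ⟨i, hiQ, hiP⟩ : ∃ i ∈ Q, i ∉ P := by
      by_contra! hall
      have := Finset.eq_of_subset_of_card_le (fun i hi => hall i hi) (heq ▸ hPc)
      exact hjQ (this ▸ hjP)
    have hiPe : i ∉ P.erase j := fun hi => hiP (Finset.mem_of_mem_erase hi)
    have hjQe : j ∉ Q.erase i := fun hj => hjQ (Finset.mem_of_mem_erase hj)
    have hcQ : (Q.erase i).card + 1 = Q.card := Finset.card_erase_add_one hiQ
    refine ⟨insert i (P.erase j), Finset.insert_subset (h (hQ hiQ)) hPe, insert j (Q.erase i),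
      Finset.insert_subset_insert _ ((Finset.erase_subset _ _).trans hQ), ?_, ?_, ?_⟩
    · rw [Finset.card_insert_of_notMem hiPe]; omega
    · rw [Finset.card_insert_of_notMem hjQe]; omega
    · rw [Finset.sum_insert hiPe, Finset.sum_insert hjQe, hsP,
        ← Finset.add_sum_erase Q u hiQ]
      ring

/-- `Phi` is submodular. -/
theorem rho_anti {u₀ : ℝ} (hu₀ : 0 < u₀) {u : Fin n → ℝ} (hu : ∀ j, 0 ≤ u j) (γ : ℕ)
    {S T : Finset (Fin n)} (h : S ⊆ T) (j : Fin n) : rho u₀ u γ j T ≤ rho u₀ u γ j S := by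
  obtain ⟨A, hA, hAc, hAe, -⟩ := exists_Phi_eq hu₀ hu γ S
  obtain ⟨B, -, -, hBe, hBm⟩ := exists_Phi_eq hu₀ hu γ (insert j S)
  obtain ⟨C, -, -, hCe, hCm⟩ := exists_Phi_eq hu₀ hu γ T
  obtain ⟨D, hD, hDc, hDe, -⟩ := exists_Phi_eq hu₀ hu γ (insert j T)
  obtain ⟨P, hP, Q, hQ, hPc, hQc, hPQ⟩ := exists_exchange (u := u) h hD hDc hA hAc
  have := hBm Q hQ hQc
  have := hCm P hP hPc
  unfold rho
  rw [hAe, hBe, hCe, hDe]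
  exact ratio_sub_ratio_le hu₀ (Finset.sum_nonneg fun j _ => hu j)
    (hBm A (hA.trans (Finset.subset_insert _ _)) hAc) (hCm A (hA.trans h) hAc)
    (Finset.sum_nonneg fun j _ => hu j) (by linarith)

/-- Add the elements of `R` one at a time; by submodularity no gain exceeds the corresponding gain
at `S`. -/
theorem Phi_union_le {u₀ : ℝ} (hu₀ : 0 < u₀) {u : Fin n → ℝ} (hu : ∀ j, 0 ≤ u j) (γ : ℕ)
    (S R : Finset (Fin n)) :
    Phi u₀ u γ (S ∪ R) ≤ Phi u₀ u γ S + ∑ j ∈ R, rho u₀ u γ j S := by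
  induction R using Finset.induction_on with
  | empty => simp
  | insert j R hj ih =>
    have := rho_anti hu₀ hu γ (Finset.subset_union_left (s₁ := S) (s₂ := R)) j
    rw [Finset.sum_insert hj, Finset.union_insert]
    simp only [rho] at *
    linarith

/-- Remove the elements of `R` one at a time; each loss is a marginal gain over a subset of `S.erase
j`, hence at least the one at `S.erase j`. -/
theorem Phi_sdiff_le {u₀ : ℝ} (hu₀ : 0 < u₀) {u : Fin n → ℝ} (hu : ∀ j, 0 ≤ u j) (γ : ℕ)
    {S R : Finset (Fin n)} (hR : R ⊆ S) :
    Phi u₀ u γ (S \ R) ≤ Phi u₀ u γ S - ∑ j ∈ R, rho u₀ u γ j (S.erase j) := by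
  induction R using Finset.induction_on with
  | empty => simp
  | insert j R hj ih =>
    have ih := ih ((Finset.subset_insert _ _).trans hR)
    have hjS : j ∈ S := hR (Finset.mem_insert_self _ _)
    have h1 : S \ insert j R ⊆ S.erase j := fun i hi => by
      simp only [Finset.mem_sdiff, Finset.mem_insert, not_or] at hi
      exact Finset.mem_erase.2 ⟨hi.2.1, hi.1⟩
    have h2 : insert j (S \ insert j R) = S \ R := by
      ext i
      by_cases hij : i = j
      · subst hij; simp [hjS, hj]
      · simp [hij]
    have h3 := rho_anti hu₀ hu γ h1 j
    have h4 : rho u₀ u γ j (S \ insert j R)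
        = Phi u₀ u γ (S \ R) - Phi u₀ u γ (S \ insert j R) := by rw [rho, h2]
    rw [Finset.sum_insert hj]
    linarith

/-! ### `phi` at 0-1 vectors -/

/-- The incidence vector of a finite set. -/
def incidence (T : Finset (Fin n)) : Fin n → ℝ := fun j => if j ∈ T then 1 else 0

theorem eq_incidence {x : Fin n → ℝ} (hx : ∀ j, x j = 0 ∨ x j = 1) :
    x = incidence (Finset.univ.filter fun j => x j = 1) := by
  funext j
  rcases hx j with h | h <;> simp [incidence, h]

theorem incidence_zero_or_one (T : Finset (Fin n)) (j : Fin n) :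
    incidence T j = 0 ∨ incidence T j = 1 := by
  by_cases h : j ∈ T <;> simp [incidence, h]

theorem sum_mul_incidence (a : Fin n → ℝ) (R T : Finset (Fin n)) :
    ∑ j ∈ R, a j * incidence T j = ∑ j ∈ R ∩ T, a j := by
  simp [incidence, Finset.sum_ite_mem]

/-- The fractional knapsack problem with a cardinality constraint has an integral optimum. -/
theorem exists_sum_mul_le {u : Fin n → ℝ} (hu : ∀ j, 0 ≤ u j) {γ : ℕ} (hγ : 1 ≤ γ)
    {T : Finset (Fin n)} {y : Fin n → ℝ} (hy : y ∈ allocations γ (incidence T)) :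
    ∃ P ⊆ T, P.card ≤ γ ∧ ∑ j, u j * y j ≤ ∑ j ∈ P, u j := by
  obtain ⟨hsum, hle, hbd⟩ := hy
  have hy0 : ∀ j ∉ T, y j = 0 := fun j hj =>
    le_antisymm (by simpa [incidence, hj] using hle j) (hbd j).1
  have hsub : ∑ j, u j * y j = ∑ j ∈ T, u j * y j :=
    (Finset.sum_subset (Finset.subset_univ _) fun j _ hj => by simp [hy0 j hj]).symm
  rw [hsub]
  rcases le_or_gt T.card γ with hT | hT
  · exact ⟨T, subset_rfl, hT, Finset.sum_le_sum fun j _ =>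
      mul_le_of_le_one_right (hu j) (hbd j).2⟩
  obtain ⟨P, hP, hmax⟩ := (T.powersetCard γ).exists_max_image (fun P => ∑ j ∈ P, u j)
    (Finset.powersetCard_nonempty.2 hT.le)
  rw [Finset.mem_powersetCard] at hP
  refine ⟨P, hP.1, hP.2.le, ?_⟩
  -- The weight `u m` acts as the dual multiplier of the cardinality constraint: `u j - u m` is
  -- nonnegative on `P` and nonpositive on `T \ P`. The bound `1 ≤ γ` makes `P` nonempty.
  obtain ⟨m, hmP, hm⟩ := P.exists_min_image u (Finset.card_pos.1 (by omega))
  have hout : ∀ k ∈ T \ P, u k ≤ u m := by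
    intro k hk
    rw [Finset.mem_sdiff] at hk
    have hkP : k ∉ P.erase m := fun h => hk.2 (Finset.mem_of_mem_erase h)
    have hc := Finset.card_erase_add_one hmP
    have := hmax (insert k (P.erase m)) (Finset.mem_powersetCard.2
      ⟨Finset.insert_subset hk.1 ((Finset.erase_subset _ _).trans hP.1), by
        rw [Finset.card_insert_of_notMem hkP]; omega⟩)
    rw [Finset.sum_insert hkP, ← Finset.add_sum_erase P u hmP] at this
    linarith
  have hyT : ∑ j ∈ T, y j ≤ γ :=
    (Finset.sum_subset (Finset.subset_univ _) fun j _ hj => hy0 j hj).trans_le hsum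
  have h1 : ∑ j ∈ T, (u j - u m) * y j ≤ ∑ j ∈ P, (u j - u m) := by
    rw [← Finset.sum_sdiff hP.1]
    have h2 : ∑ j ∈ T \ P, (u j - u m) * y j ≤ 0 := Finset.sum_nonpos fun j hj =>
      mul_nonpos_of_nonpos_of_nonneg (by linarith [hout j hj]) (hbd j).1
    have h3 : ∑ j ∈ P, (u j - u m) * y j ≤ ∑ j ∈ P, (u j - u m) := Finset.sum_le_sum fun j hj =>
      mul_le_of_le_one_right (by linarith [hm j hj]) (hbd j).2
    linarith
  simp only [sub_mul, Finset.sum_sub_distrib, ← Finset.mul_sum, Finset.sum_const, hP.2,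
    nsmul_eq_mul] at h1
  have := mul_le_mul_of_nonneg_left hyT (hu m)
  linarith

theorem phi_incidence {u₀ : ℝ} (hu₀ : 0 < u₀) {u : Fin n → ℝ} (hu : ∀ j, 0 ≤ u j) {γ : ℕ}
    (hγ : 1 ≤ γ) (T : Finset (Fin n)) : phi u₀ u γ (incidence T) = Phi u₀ u γ T := by
  have hG := exists_isGreatest_share u₀ hu₀ u hu γ (incidence T)
    (fun j => by rcases incidence_zero_or_one T j with h | h <;> simp [h])
  obtain ⟨P, hP, hPc, hPe, hPm⟩ := exists_Phi_eq hu₀ hu γ T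
  apply le_antisymm
  · obtain ⟨y, hy, hye⟩ := hG.1
    obtain ⟨Q, hQ, hQc, hQs⟩ := exists_sum_mul_le hu hγ hy
    rw [← hye, hPe]
    exact ratio_le_ratio hu₀ (Finset.sum_nonneg fun j _ => mul_nonneg (hu j) (hy.2.2 j).1)
      (hQs.trans (hPm Q hQ hQc))
  · refine hG.2 ⟨incidence P, ⟨?_, fun j => ?_, fun j => ?_⟩, ?_⟩
    · have := sum_mul_incidence (fun _ => 1) Finset.univ P
      simp only [one_mul, Finset.univ_inter, Finset.sum_const, nsmul_eq_mul, mul_one] at this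
      rw [this]
      exact_mod_cast hPc
    · by_cases h : j ∈ P
      · simp [incidence, h, hP h]
      · simp only [incidence, h, if_false]; split_ifs <;> norm_num
    · rcases incidence_zero_or_one P j with h | h <;> simp [h]
    · rw [hPe, share, sum_mul_incidence, Finset.univ_inter]

/-! ### A criterion for facets -/

/-- The 0-1 points at which the inequality `w ≤ r(x)` is tight. -/
def tightPoints (u₀ : ℝ) (u : Fin n → ℝ) (γ : ℕ) (r : (Fin n → ℝ) → ℝ) : Set (Fin n → ℝ) :=
  {x | (r x, x) ∈ X u₀ u γ}

theorem eq_top_of_forall_single_mem {W : Submodule ℝ (Fin n → ℝ)}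
    (h : ∀ j, (Pi.single j 1 : Fin n → ℝ) ∈ W) : W = ⊤ := by
  refine eq_top_iff.2 fun x _ => ?_
  rw [pi_eq_sum_univ' x]
  exact W.sum_mem fun j _ => W.smul_mem _ (h j)

/-- One elimination step of the triangular argument: subtract from `d` its components already known
to lie in `W`, then rescale. -/
theorem single_mem_of_mem {W : Submodule ℝ (Fin n → ℝ)} {d : Fin n → ℝ} (hd : d ∈ W) {i : Fin n}
    (hi : d i ≠ 0) (h : ∀ j, j ≠ i → d j = 0 ∨ (Pi.single j 1 : Fin n → ℝ) ∈ W) :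
    (Pi.single i 1 : Fin n → ℝ) ∈ W := by
  have hsum : ∑ j ∈ Finset.univ.erase i, d j • (Pi.single j 1 : Fin n → ℝ) ∈ W := by
    refine W.sum_mem fun j hj => ?_
    rcases h j (Finset.ne_of_mem_erase hj) with h | h
    · simp [h]
    · exact W.smul_mem _ h
  have hdi : d i • (Pi.single i 1 : Fin n → ℝ) ∈ W := by
    have := pi_eq_sum_univ' d
    rw [← Finset.add_sum_erase _ _ (Finset.mem_univ i)] at this
    have hsub := W.sub_mem hd hsum
    nth_rewrite 1 [this] at hsub
    simpa using hsub
  simpa [hi] using W.smul_mem (d i)⁻¹ hdi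

/-- The face is the graph of `A` over its projection, so it has dimension `n` once the tight points
span all directions. The hull has one dimension more, because `w` can be decreased freely. -/
theorem isFacetDefining_of_tightPoints {u₀ : ℝ} {u : Fin n → ℝ} {γ : ℕ} {r : (Fin n → ℝ) → ℝ}
    (A : (Fin n → ℝ) →ᵃ[ℝ] ℝ) (hA : ∀ x, r x = A x)
    (hvalid : ∀ p ∈ X u₀ u γ, p.1 ≤ r p.2) (hne : (tightPoints u₀ u γ r).Nonempty)
    (hspan : ∀ j, (Pi.single j 1 : Fin n → ℝ) ∈ vectorSpan ℝ (tightPoints u₀ u γ r)) :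
    IsFacetDefining (convexHull ℝ (X u₀ u γ)) r := by
  obtain rfl : r = A := funext hA
  set V := tightPoints u₀ u γ A with hV
  set P := convexHull ℝ (X u₀ u γ) with hP
  set F := {p ∈ P | p.1 = A p.2} with hF
  let G : (Fin n → ℝ) →ᵃ[ℝ] ℝ × (Fin n → ℝ) := A.prod (AffineMap.id ℝ _)
  have hVtop := eq_top_of_forall_single_mem hspan
  have hGV : G '' V ⊆ F := by
    rintro _ ⟨x, hx, rfl⟩
    exact ⟨subset_convexHull ℝ _ hx, rfl⟩
  have hFG : F = G '' (Prod.snd '' F) := by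
    ext p
    constructor
    · intro hp
      exact ⟨p.2, ⟨p, hp, rfl⟩, Prod.ext hp.2.symm rfl⟩
    · rintro ⟨_, ⟨q, hq, rfl⟩, rfl⟩
      have : G q.2 = q := Prod.ext hq.2.symm rfl
      rwa [this]
  have hVF : V ⊆ Prod.snd '' F := fun x hx => ⟨G x, hGV ⟨x, hx, rfl⟩, rfl⟩
  have hsnd : vectorSpan ℝ (Prod.snd '' F) = ⊤ :=
    top_le_iff.1 (hVtop ▸ vectorSpan_mono ℝ hVF)
  have hGinj : Function.Injective G.linear := fun x y hxy => congrArg Prod.snd hxy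
  have hspanF : vectorSpan ℝ F = Submodule.map G.linear ⊤ := by
    rw [hFG, ← AffineMap.map_vectorSpan, hsnd]
  have hFfin : Module.finrank ℝ (vectorSpan ℝ F) = n := by
    rw [hspanF, Submodule.map_top, LinearMap.finrank_range_of_inj hGinj, Module.finrank_fin_fun]
  have hPtop : vectorSpan ℝ P = ⊤ := by
    have hle : vectorSpan ℝ F ≤ vectorSpan ℝ P := vectorSpan_mono ℝ fun p hp => hp.1
    have h10 : ((1 : ℝ), (0 : Fin n → ℝ)) ∈ vectorSpan ℝ P := by
      obtain ⟨x, hx⟩ := hne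
      have hx' : ((A x - 1, x) : ℝ × (Fin n → ℝ)) ∈ X u₀ u γ := ⟨hx.1, by
        have := hx.2
        simp only at this ⊢
        linarith⟩
      have := vsub_mem_vectorSpan ℝ (subset_convexHull ℝ (X u₀ u γ) hx)
        (subset_convexHull ℝ (X u₀ u γ) hx')
      simpa using this
    refine eq_top_iff.2 fun p _ => ?_
    have h1 : G.linear p.2 ∈ vectorSpan ℝ P :=
      hle (hspanF ▸ Submodule.mem_map_of_mem trivial)
    have h2 := Submodule.add_mem _ h1
      (Submodule.smul_mem _ (p.1 - (G.linear p.2).1) h10)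
    have h3 : G.linear p.2 + (p.1 - (G.linear p.2).1) • ((1 : ℝ), (0 : Fin n → ℝ)) = p := by
      refine Prod.ext ?_ ?_
      · simp
      · simp [G]
    rwa [h3] at h2
  refine ⟨fun p hp => ?_, (hne.image G).mono hGV, ?_⟩
  · have hconv : Convex ℝ {p : ℝ × (Fin n → ℝ) | p.1 ≤ A p.2} := by
      intro p hp q hq a b ha hb hab
      have hcomb := Convex.combo_affine_apply (f := A) (x := p.2) (y := q.2) hab
      simp only [Set.mem_ofPred_eq, Prod.fst_add, Prod.smul_fst, Prod.snd_add, Prod.smul_snd,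
        smul_eq_mul] at *
      rw [hcomb]
      exact add_le_add (mul_le_mul_of_nonneg_left hp ha) (mul_le_mul_of_nonneg_left hq hb)
    exact convexHull_min (fun p hp => hvalid p hp) hconv hp
  · rw [hFfin, hPtop, finrank_top]
    simp [Module.finrank_prod, add_comm]

/-! ### Sums over initial segments -/

theorem sum_subtype_lt_eq {m : ℕ} (f : Fin m → ℝ) (ℓ : Fin m) :
    ∑ τ : {τ // τ < ℓ}, f τ.1 = ∑ τ ∈ Finset.Iio ℓ, f τ :=
  (Finset.sum_subtype _ (fun τ => Finset.mem_Iio) f).symm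

theorem sum_eq_Iio_add_Ioi {m : ℕ} (f : Fin m → ℝ) (ℓ : Fin m) :
    ∑ τ, f τ = ∑ τ ∈ Finset.Iio ℓ, f τ + f ℓ + ∑ τ ∈ Finset.Ioi ℓ, f τ := by
  have h : (Finset.univ : Finset (Fin m)) = Finset.Iic ℓ ∪ Finset.Ioi ℓ := by
    ext τ; simpa using le_or_gt τ ℓ
  rw [h, Finset.sum_union (Finset.disjoint_left.2 fun τ h1 h2 =>
    absurd (Finset.mem_Ioi.1 h2) (not_lt.2 (Finset.mem_Iic.1 h1))), ← Finset.Iio_insert,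
    Finset.sum_insert (by simp), add_comm (f ℓ)]

/-! ### Down-lifting -/

theorem mem_X_incidence {u₀ : ℝ} (hu₀ : 0 < u₀) {u : Fin n → ℝ} (hu : ∀ j, 0 ≤ u j) {γ : ℕ}
    (hγ : 1 ≤ γ) (T : Finset (Fin n)) : (Phi u₀ u γ T, incidence T) ∈ X u₀ u γ :=
  ⟨incidence_zero_or_one T, (phi_incidence hu₀ hu hγ T).ge⟩

/-- The constraints of the down-lifting problem for `σ ℓ`. -/
theorem mem_XRestr_down {u₀ : ℝ} {u : Fin n → ℝ} {γ : ℕ} {S : Finset (Fin n)}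
    {σ : Fin S.card ≃ S} {ℓ : Fin S.card} {p : ℝ × (Fin n → ℝ)} :
    p ∈ XRestr u₀ u γ {(σ ℓ : Fin n)} ((Finset.Ioi ℓ).image fun τ => (σ τ : Fin n)) ↔
      p ∈ X u₀ u γ ∧ p.2 (σ ℓ) = 0 ∧ ∀ τ, ℓ < τ → p.2 (σ τ) = 1 := by
  simp only [XRestr, Set.mem_ofPred_eq, Finset.mem_singleton, forall_eq,
    Finset.forall_mem_image, Finset.mem_Ioi]

/-- Substituting the recursion for `eta` cancels the constants. Validity and tightness at such `x`
then reduce to comparison with the maximum of the lifting problem for `σ ℓ`. -/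
theorem downLiftedRhs_eq {u₀ : ℝ} {u : Fin n → ℝ} {γ : ℕ} {S : Finset (Fin n)}
    {σ : Fin S.card ≃ S} {ℓ : Fin S.card} {x : Fin n → ℝ} (h0 : x (σ ℓ) = 0)
    (h1 : ∀ τ, ℓ < τ → x (σ τ) = 1) :
    downLiftedRhs u₀ u γ S σ x =
      liftMax u₀ u γ {(σ ℓ : Fin n)} ((Finset.Ioi ℓ).image fun τ => (σ τ : Fin n))
        (fun x => ∑ j ∈ Sᶜ, rho u₀ u γ j S * x j
          + ∑ τ : {τ // τ < ℓ}, eta u₀ u γ S σ τ.1 * x (σ τ.1))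
      + (∑ j ∈ Sᶜ, rho u₀ u γ j S * x j
          + ∑ τ : {τ // τ < ℓ}, eta u₀ u γ S σ τ.1 * x (σ τ.1)) := by
  have hη := eta.eq_1 u₀ u γ S σ ℓ
  have h2 : ∑ τ ∈ Finset.Ioi ℓ, eta u₀ u γ S σ τ * (1 - x (σ τ)) = 0 :=
    Finset.sum_eq_zero fun τ hτ => by simp [h1 τ (Finset.mem_Ioi.1 hτ)]
  have h3 := sum_eq_Iio_add_Ioi (fun τ => eta u₀ u γ S σ τ * (1 - x (σ τ))) ℓ
  have h4 := sum_subtype_lt_eq (fun τ => eta u₀ u γ S σ τ * x (σ τ)) ℓ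
  have h5 := sum_subtype_lt_eq (fun τ => eta u₀ u γ S σ τ) ℓ
  have h6 : ∑ τ ∈ Finset.Iio ℓ, eta u₀ u γ S σ τ * (1 - x (σ τ))
      = ∑ τ ∈ Finset.Iio ℓ, eta u₀ u γ S σ τ
        - ∑ τ ∈ Finset.Iio ℓ, eta u₀ u γ S σ τ * x (σ τ) := by
    rw [← Finset.sum_sub_distrib]
    exact Finset.sum_congr rfl fun τ _ => by ring
  simp only [h0] at h3
  rw [downLiftedRhs]
  linarith

theorem disjoint_singleton_image_Ioi {S : Finset (Fin n)} {m : ℕ} (σ : Fin m ≃ S) (ℓ : Fin m) :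
    Disjoint {(σ ℓ : Fin n)} ((Finset.Ioi ℓ).image fun τ => (σ τ : Fin n)) := by
  rw [Finset.disjoint_singleton_left]
  intro h
  obtain ⟨τ, hτ, he⟩ := Finset.mem_image.1 h
  have : τ = ℓ := σ.injective (Subtype.ext he)
  exact absurd (Finset.mem_Ioi.1 hτ) (by simp [this])

theorem downLiftedRhs_valid {u₀ : ℝ} (hu₀ : 0 < u₀) {u : Fin n → ℝ} (hu : ∀ j, 0 ≤ u j) {γ : ℕ}
    (hγ : 1 ≤ γ) (S : Finset (Fin n)) (σ : Fin S.card ≃ S) {p : ℝ × (Fin n → ℝ)}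
    (hp : p ∈ X u₀ u γ) : p.1 ≤ downLiftedRhs u₀ u γ S σ p.2 := by
  by_cases hall : ∀ ℓ, p.2 (σ ℓ) = 1
  · obtain ⟨T, hT⟩ : ∃ T, p.2 = incidence T := ⟨_, eq_incidence hp.1⟩
    have hST : S ⊆ T := fun j hj => by
      have := hall (σ.symm ⟨j, hj⟩)
      by_contra hjT
      simp [hT, incidence, hjT] at this
    have h1 := hp.2
    rw [hT, phi_incidence hu₀ hu hγ] at h1
    have h2 := Phi_union_le hu₀ hu γ S (Sᶜ ∩ T)
    have h3 : S ∪ Sᶜ ∩ T = T := by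
      ext j
      by_cases hj : j ∈ S
      · simp [hj, hST hj]
      · simp [hj]
    rw [h3] at h2
    simp only [downLiftedRhs, hall]
    rw [hT, sum_mul_incidence]
    simp only [sub_self, mul_zero, Finset.sum_const_zero, sub_zero]
    linarith
  · push Not at hall
    obtain ⟨ℓ₀, hℓ₀⟩ := hall
    -- Taking the last zero makes all later coordinates equal to one, so `p` is feasible for the
    -- lifting problem at `ℓ`; no induction on `ℓ` is needed.
    obtain ⟨ℓ, hℓ, hmax⟩ := (Finset.univ.filter fun ℓ => p.2 (σ ℓ) ≠ 1).exists_max_image id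
      ⟨ℓ₀, by simpa using hℓ₀⟩
    simp only [Finset.mem_filter, Finset.mem_univ, true_and, id] at hℓ hmax
    have h0 : p.2 (σ ℓ) = 0 := (hp.1 _).resolve_right hℓ
    have h1 : ∀ τ, ℓ < τ → p.2 (σ τ) = 1 := fun τ hτ => by
      by_contra h
      exact absurd (hmax τ h) (not_le.2 hτ)
    rw [downLiftedRhs_eq h0 h1, ← sub_le_iff_le_add]
    exact (isGreatest_liftMax u₀ u γ _ _ (disjoint_singleton_image_Ioi σ ℓ) _).2
      ⟨p, mem_XRestr_down.2 ⟨hp, h0, h1⟩, rfl⟩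

theorem exists_tight_down (u₀ : ℝ) (u : Fin n → ℝ) (γ : ℕ) (S : Finset (Fin n))
    (σ : Fin S.card ≃ S) (ℓ : Fin S.card) :
    ∃ x ∈ tightPoints u₀ u γ (downLiftedRhs u₀ u γ S σ),
      x (σ ℓ) = 0 ∧ ∀ τ, ℓ < τ → x (σ τ) = 1 := by
  obtain ⟨p, hp, he⟩ := (isGreatest_liftMax u₀ u γ _ _ (disjoint_singleton_image_Ioi σ ℓ)
    (fun x => ∑ j ∈ Sᶜ, rho u₀ u γ j S * x j
          + ∑ τ : {τ // τ < ℓ}, eta u₀ u γ S σ τ.1 * x (σ τ.1))).1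
  obtain ⟨hX, h0, h1⟩ := mem_XRestr_down.1 hp
  refine ⟨p.2, ?_, h0, h1⟩
  have : downLiftedRhs u₀ u γ S σ p.2 = p.1 := by
    rw [downLiftedRhs_eq h0 h1, ← he]
    simp
  rw [tightPoints, Set.mem_ofPred_eq, this]
  exact hX

theorem incidence_mem_tight_down {u₀ : ℝ} (hu₀ : 0 < u₀) {u : Fin n → ℝ} (hu : ∀ j, 0 ≤ u j)
    {γ : ℕ} (hγ : 1 ≤ γ) (S : Finset (Fin n)) (σ : Fin S.card ≃ S) :
    incidence S ∈ tightPoints u₀ u γ (downLiftedRhs u₀ u γ S σ) := by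
  have : downLiftedRhs u₀ u γ S σ (incidence S) = Phi u₀ u γ S := by
    rw [downLiftedRhs, sum_mul_incidence, Finset.inter_comm, Finset.inter_compl]
    simp [incidence]
  rw [tightPoints, Set.mem_ofPred_eq, this]
  exact mem_X_incidence hu₀ hu hγ S

theorem incidence_insert_mem_tight_down {u₀ : ℝ} (hu₀ : 0 < u₀) {u : Fin n → ℝ}
    (hu : ∀ j, 0 ≤ u j) {γ : ℕ} (hγ : 1 ≤ γ) (S : Finset (Fin n)) (σ : Fin S.card ≃ S)
    {j : Fin n} (hj : j ∉ S) :
    incidence (insert j S) ∈ tightPoints u₀ u γ (downLiftedRhs u₀ u γ S σ) := by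
  have : downLiftedRhs u₀ u γ S σ (incidence (insert j S)) = Phi u₀ u γ (insert j S) := by
    have h : Sᶜ ∩ insert j S = {j} := by
      ext i
      by_cases hi : i ∈ S
      · simp [hi]; rintro rfl; exact hj hi
      · simp [hi]
    rw [downLiftedRhs, sum_mul_incidence, h]
    simp [incidence, rho]
  rw [tightPoints, Set.mem_ofPred_eq, this]
  exact mem_X_incidence hu₀ hu hγ _

theorem incidence_insert_sub {S : Finset (Fin n)} {j : Fin n} (hj : j ∉ S) :
    incidence (insert j S) - incidence S = Pi.single j 1 := by
  funext i
  by_cases hij : i = j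
  · subst hij; simp [incidence, hj]
  · simp [incidence, hij]

theorem isFacetDefining_downLifted {u₀ : ℝ} (hu₀ : 0 < u₀) {u : Fin n → ℝ} (hu : ∀ j, 0 ≤ u j)
    {γ : ℕ} (hγ : 1 ≤ γ) (S : Finset (Fin n)) (σ : Fin S.card ≃ S) :
    IsFacetDefining (convexHull ℝ (X u₀ u γ)) (downLiftedRhs u₀ u γ S σ) := by
  have hS := incidence_mem_tight_down hu₀ hu hγ S σ
  have hout : ∀ j ∉ S, (Pi.single j 1 : Fin n → ℝ) ∈
      vectorSpan ℝ (tightPoints u₀ u γ (downLiftedRhs u₀ u γ S σ)) := fun j hj => by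
    rw [← incidence_insert_sub hj]
    exact vsub_mem_vectorSpan ℝ (incidence_insert_mem_tight_down hu₀ hu hγ S σ hj) hS
  have hin : ∀ ℓ, (Pi.single (σ ℓ : Fin n) 1 : Fin n → ℝ) ∈
      vectorSpan ℝ (tightPoints u₀ u γ (downLiftedRhs u₀ u γ S σ)) := fun ℓ => by
    induction ℓ using WellFoundedLT.induction with
    | _ ℓ ih =>
      obtain ⟨x, hx, h0, h1⟩ := exists_tight_down u₀ u γ S σ ℓ
      -- The difference has entry one at `σ ℓ` and zero at later positions; earlier positions are
      -- covered by induction and those outside `S` by `hout`.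
      refine single_mem_of_mem (vsub_mem_vectorSpan ℝ hS hx) ?_ fun j hj => ?_
      · simp [incidence, h0]
      by_cases hjS : j ∈ S
      · obtain ⟨τ, hτ⟩ := σ.surjective ⟨j, hjS⟩
        obtain rfl : (σ τ : Fin n) = j := by rw [hτ]
        rcases lt_trichotomy τ ℓ with h | rfl | h
        · exact Or.inr (ih τ h)
        · exact absurd rfl hj
        · left; simp [incidence, h1 τ h]
      · exact Or.inr (hout j hjS)
  refine isFacetDefining_of_tightPoints
    ((∑ j ∈ Sᶜ, rho u₀ u γ j S • LinearMap.proj j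
      + ∑ ℓ, eta u₀ u γ S σ ℓ • LinearMap.proj (σ ℓ : Fin n) :
        (Fin n → ℝ) →ₗ[ℝ] ℝ).toAffineMap
      + AffineMap.const ℝ _ (Phi u₀ u γ S - ∑ ℓ, eta u₀ u γ S σ ℓ)) (fun x => ?_)
    (fun p hp => downLiftedRhs_valid hu₀ hu hγ S σ hp) ⟨_, hS⟩ fun j => ?_
  · simp only [downLiftedRhs, mul_sub, mul_one, Finset.sum_sub_distrib,
      LinearMap.coe_toAffineMap, LinearMap.add_apply, LinearMap.sum_apply, LinearMap.smul_apply,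
      LinearMap.proj_apply, smul_eq_mul, AffineMap.const_apply, AffineMap.coe_add, Pi.add_apply]
    ring
  · by_cases hjS : j ∈ S
    · simpa using hin (σ.symm ⟨j, hjS⟩)
    · exact hout j hjS

/-! ### Up-lifting -/

/-- The constraints of the up-lifting problem for `σ ℓ`. -/
theorem mem_XRestr_up {u₀ : ℝ} {u : Fin n → ℝ} {γ : ℕ} {S : Finset (Fin n)}
    {σ : Fin Sᶜ.card ≃ (Sᶜ : Finset (Fin n))} {ℓ : Fin Sᶜ.card} {p : ℝ × (Fin n → ℝ)} :
    p ∈ XRestr u₀ u γ ((Finset.Ioi ℓ).image fun τ => (σ τ : Fin n)) {(σ ℓ : Fin n)} ↔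
      p ∈ X u₀ u γ ∧ p.2 (σ ℓ) = 1 ∧ ∀ τ, ℓ < τ → p.2 (σ τ) = 0 := by
  simp only [XRestr, Set.mem_ofPred_eq, Finset.mem_singleton, forall_eq,
    Finset.forall_mem_image, Finset.mem_Ioi]
  tauto

/-- As for down-lifting, except that the recursion carries no constant sum of earlier coefficients,
since the lifted terms are `ζ x` and not `η (1 - x)`. -/
theorem upLiftedRhs_eq {u₀ : ℝ} {u : Fin n → ℝ} {γ : ℕ} {S : Finset (Fin n)}
    {σ : Fin Sᶜ.card ≃ (Sᶜ : Finset (Fin n))} {ℓ : Fin Sᶜ.card} {x : Fin n → ℝ}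
    (h1 : x (σ ℓ) = 1) (h0 : ∀ τ, ℓ < τ → x (σ τ) = 0) :
    upLiftedRhs u₀ u γ S σ x =
      liftMax u₀ u γ ((Finset.Ioi ℓ).image fun τ => (σ τ : Fin n)) {(σ ℓ : Fin n)}
        (fun x => ∑ j ∈ S, rho u₀ u γ j (S.erase j) * x j
          + ∑ τ : {τ // τ < ℓ}, zeta u₀ u γ S σ τ.1 * x (σ τ.1))
      + (∑ j ∈ S, rho u₀ u γ j (S.erase j) * x j
          + ∑ τ : {τ // τ < ℓ}, zeta u₀ u γ S σ τ.1 * x (σ τ.1)) := by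
  have hζ := zeta.eq_1 u₀ u γ S σ ℓ
  have h2 : ∑ τ ∈ Finset.Ioi ℓ, zeta u₀ u γ S σ τ * x (σ τ) = 0 :=
    Finset.sum_eq_zero fun τ hτ => by simp [h0 τ (Finset.mem_Ioi.1 hτ)]
  have h3 := sum_eq_Iio_add_Ioi (fun τ => zeta u₀ u γ S σ τ * x (σ τ)) ℓ
  have h4 := sum_subtype_lt_eq (fun τ => zeta u₀ u γ S σ τ * x (σ τ)) ℓ
  simp only [h1] at h3
  simp only [upLiftedRhs, mul_sub, mul_one, Finset.sum_sub_distrib]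
  linarith

theorem upLiftedRhs_valid {u₀ : ℝ} (hu₀ : 0 < u₀) {u : Fin n → ℝ} (hu : ∀ j, 0 ≤ u j) {γ : ℕ}
    (hγ : 1 ≤ γ) (S : Finset (Fin n)) (σ : Fin Sᶜ.card ≃ (Sᶜ : Finset (Fin n)))
    {p : ℝ × (Fin n → ℝ)} (hp : p ∈ X u₀ u γ) : p.1 ≤ upLiftedRhs u₀ u γ S σ p.2 := by
  by_cases hall : ∀ ℓ, p.2 (σ ℓ) = 0
  · obtain ⟨T, hT⟩ : ∃ T, p.2 = incidence T := ⟨_, eq_incidence hp.1⟩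
    have hTS : T ⊆ S := fun j hj => by
      by_contra hjS
      have := hall (σ.symm ⟨j, Finset.mem_compl.2 hjS⟩)
      simp [hT, incidence, hj] at this
    have h1 := hp.2
    rw [hT, phi_incidence hu₀ hu hγ] at h1
    have h2 := Phi_sdiff_le hu₀ hu γ (Finset.sdiff_subset (s := S) (t := T))
    rw [Finset.sdiff_sdiff_eq_self hTS] at h2
    have h3 := Finset.sum_sdiff hTS (f := fun j => rho u₀ u γ j (S.erase j))
    simp only [upLiftedRhs, hall, mul_sub, mul_one, Finset.sum_sub_distrib]
    rw [hT, sum_mul_incidence, Finset.inter_eq_right.2 hTS]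
    simp only [mul_zero, Finset.sum_const_zero, add_zero]
    linarith
  · push Not at hall
    obtain ⟨ℓ₀, hℓ₀⟩ := hall
    -- Here the last coordinate equal to one selects the lifting problem for which `p` is feasible.
    obtain ⟨ℓ, hℓ, hmax⟩ := (Finset.univ.filter fun ℓ => p.2 (σ ℓ) ≠ 0).exists_max_image id
      ⟨ℓ₀, by simpa using hℓ₀⟩
    simp only [Finset.mem_filter, Finset.mem_univ, true_and, id] at hℓ hmax
    have h1 : p.2 (σ ℓ) = 1 := (hp.1 _).resolve_left hℓ
    have h0 : ∀ τ, ℓ < τ → p.2 (σ τ) = 0 := fun τ hτ => by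
      by_contra h
      exact absurd (hmax τ h) (not_le.2 hτ)
    rw [upLiftedRhs_eq h1 h0, ← sub_le_iff_le_add]
    exact (isGreatest_liftMax u₀ u γ _ _ (disjoint_singleton_image_Ioi σ ℓ).symm _).2
      ⟨p, mem_XRestr_up.2 ⟨hp, h1, h0⟩, rfl⟩

theorem exists_tight_up (u₀ : ℝ) (u : Fin n → ℝ) (γ : ℕ) (S : Finset (Fin n))
    (σ : Fin Sᶜ.card ≃ (Sᶜ : Finset (Fin n))) (ℓ : Fin Sᶜ.card) :
    ∃ x ∈ tightPoints u₀ u γ (upLiftedRhs u₀ u γ S σ),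
      x (σ ℓ) = 1 ∧ ∀ τ, ℓ < τ → x (σ τ) = 0 := by
  obtain ⟨p, hp, he⟩ := (isGreatest_liftMax u₀ u γ _ _ (disjoint_singleton_image_Ioi σ ℓ).symm
    (fun x => ∑ j ∈ S, rho u₀ u γ j (S.erase j) * x j
          + ∑ τ : {τ // τ < ℓ}, zeta u₀ u γ S σ τ.1 * x (σ τ.1))).1
  obtain ⟨hX, h1, h0⟩ := mem_XRestr_up.1 hp
  refine ⟨p.2, ?_, h1, h0⟩
  have : upLiftedRhs u₀ u γ S σ p.2 = p.1 := by
    rw [upLiftedRhs_eq h1 h0, ← he]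
    simp
  rw [tightPoints, Set.mem_ofPred_eq, this]
  exact hX

/-- Lifted terms vanish on subsets of `S`. The cases `T = S` and `T = S.erase j` give the tight
points that need no lifting. -/
theorem upLiftedRhs_incidence {u₀ : ℝ} {u : Fin n → ℝ} {γ : ℕ} {S T : Finset (Fin n)}
    (σ : Fin Sᶜ.card ≃ (Sᶜ : Finset (Fin n))) (hTS : T ⊆ S) :
    upLiftedRhs u₀ u γ S σ (incidence T)
      = Phi u₀ u γ S - ∑ j ∈ S \ T, rho u₀ u γ j (S.erase j) := by
  have h : ∀ ℓ, (σ ℓ : Fin n) ∉ T := fun ℓ hℓ =>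
    Finset.mem_compl.1 (σ ℓ).2 (hTS hℓ)
  have h3 := Finset.sum_sdiff hTS (f := fun j => rho u₀ u γ j (S.erase j))
  have h4 : ∑ ℓ, zeta u₀ u γ S σ ℓ * incidence T (σ ℓ) = 0 :=
    Finset.sum_eq_zero fun ℓ _ => by simp [incidence, h ℓ]
  simp only [upLiftedRhs, mul_sub, mul_one, Finset.sum_sub_distrib]
  rw [h4, sum_mul_incidence, Finset.inter_eq_right.2 hTS]
  linarith

theorem incidence_mem_tight_up {u₀ : ℝ} (hu₀ : 0 < u₀) {u : Fin n → ℝ} (hu : ∀ j, 0 ≤ u j)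
    {γ : ℕ} (hγ : 1 ≤ γ) (S : Finset (Fin n)) (σ : Fin Sᶜ.card ≃ (Sᶜ : Finset (Fin n))) :
    incidence S ∈ tightPoints u₀ u γ (upLiftedRhs u₀ u γ S σ) := by
  rw [tightPoints, Set.mem_ofPred_eq, upLiftedRhs_incidence σ subset_rfl]
  simpa using mem_X_incidence hu₀ hu hγ S

theorem incidence_erase_mem_tight_up {u₀ : ℝ} (hu₀ : 0 < u₀) {u : Fin n → ℝ}
    (hu : ∀ j, 0 ≤ u j) {γ : ℕ} (hγ : 1 ≤ γ) (S : Finset (Fin n))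
    (σ : Fin Sᶜ.card ≃ (Sᶜ : Finset (Fin n))) {j : Fin n} (hj : j ∈ S) :
    incidence (S.erase j) ∈ tightPoints u₀ u γ (upLiftedRhs u₀ u γ S σ) := by
  rw [tightPoints, Set.mem_ofPred_eq, upLiftedRhs_incidence σ (Finset.erase_subset _ _),
    Finset.sdiff_erase_self hj, Finset.sum_singleton, rho, Finset.insert_erase hj, sub_sub_cancel]
  exact mem_X_incidence hu₀ hu hγ _

theorem isFacetDefining_upLifted {u₀ : ℝ} (hu₀ : 0 < u₀) {u : Fin n → ℝ} (hu : ∀ j, 0 ≤ u j)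
    {γ : ℕ} (hγ : 1 ≤ γ) (S : Finset (Fin n)) (σ : Fin Sᶜ.card ≃ (Sᶜ : Finset (Fin n))) :
    IsFacetDefining (convexHull ℝ (X u₀ u γ)) (upLiftedRhs u₀ u γ S σ) := by
  have hS := incidence_mem_tight_up hu₀ hu hγ S σ
  have hin : ∀ j ∈ S, (Pi.single j 1 : Fin n → ℝ) ∈
      vectorSpan ℝ (tightPoints u₀ u γ (upLiftedRhs u₀ u γ S σ)) := fun j hj => by
    rw [← incidence_insert_sub (Finset.notMem_erase j S), Finset.insert_erase hj]
    exact vsub_mem_vectorSpan ℝ hS (incidence_erase_mem_tight_up hu₀ hu hγ S σ hj)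
  have hout : ∀ ℓ, (Pi.single (σ ℓ : Fin n) 1 : Fin n → ℝ) ∈
      vectorSpan ℝ (tightPoints u₀ u γ (upLiftedRhs u₀ u γ S σ)) := fun ℓ => by
    induction ℓ using WellFoundedLT.induction with
    | _ ℓ ih =>
      obtain ⟨x, hx, h1, h0⟩ := exists_tight_up u₀ u γ S σ ℓ
      have hσ : ∀ τ, (σ τ : Fin n) ∉ S := fun τ => Finset.mem_compl.1 (σ τ).2
      -- Triangularity again: entry one at `σ ℓ`, zero at later positions, and all remaining
      -- directions already in the span.
      refine single_mem_of_mem (vsub_mem_vectorSpan ℝ hx hS) ?_ fun j hj => ?_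
      · simp [incidence, h1, hσ]
      by_cases hjS : j ∈ S
      · exact Or.inr (hin j hjS)
      · obtain ⟨τ, hτ⟩ := σ.surjective ⟨j, Finset.mem_compl.2 hjS⟩
        obtain rfl : (σ τ : Fin n) = j := by rw [hτ]
        rcases lt_trichotomy τ ℓ with h | rfl | h
        · exact Or.inr (ih τ h)
        · exact absurd rfl hj
        · left; simp [incidence, h0 τ h, hσ]
  refine isFacetDefining_of_tightPoints
    ((∑ j ∈ S, rho u₀ u γ j (S.erase j) • LinearMap.proj j
      + ∑ ℓ, zeta u₀ u γ S σ ℓ • LinearMap.proj (σ ℓ : Fin n) :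
        (Fin n → ℝ) →ₗ[ℝ] ℝ).toAffineMap
      + AffineMap.const ℝ _ (Phi u₀ u γ S - ∑ j ∈ S, rho u₀ u γ j (S.erase j))) (fun x => ?_)
    (fun p hp => upLiftedRhs_valid hu₀ hu hγ S σ hp) ⟨_, hS⟩ fun j => ?_
  · simp only [upLiftedRhs, mul_sub, mul_one, Finset.sum_sub_distrib,
      LinearMap.coe_toAffineMap, LinearMap.add_apply, LinearMap.sum_apply, LinearMap.smul_apply,
      LinearMap.proj_apply, smul_eq_mul, AffineMap.const_apply, AffineMap.coe_add, Pi.add_apply]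
    ring
  · by_cases hjS : j ∈ S
    · exact hin j hjS
    · simpa using hout (σ.symm ⟨j, Finset.mem_compl.2 hjS⟩)

end LiftedSubmodular

theorem proposition3 {n : ℕ} (u₀ : ℝ) (hu₀ : 0 < u₀) (u : Fin n → ℝ) (hu : ∀ j, 0 ≤ u j)
    (hanti : Antitone u) (γ : ℕ) (hγ : 1 ≤ γ) (S : Finset (Fin n)) :
    (∀ σ : Fin S.card ≃ S,
      LiftedSubmodular.IsFacetDefining (convexHull ℝ (LiftedSubmodular.X u₀ u γ))
        (LiftedSubmodular.downLiftedRhs u₀ u γ S σ)) ∧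
    (∀ σ : Fin Sᶜ.card ≃ (Sᶜ : Finset (Fin n)),
      LiftedSubmodular.IsFacetDefining (convexHull ℝ (LiftedSubmodular.X u₀ u γ))
        (LiftedSubmodular.upLiftedRhs u₀ u γ S σ)) :=
  ⟨fun σ => LiftedSubmodular.isFacetDefining_downLifted hu₀ hu hγ S σ,
    fun σ => LiftedSubmodular.isFacetDefining_upLifted hu₀ hu hγ S σ⟩
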